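/- Let $\mathcal C$ be a category with finite limits and let $(\mathsf L,\mathsf R)$ be a weak factorization system on $\mathcal C$. Compositions are written in the usual order ($gf$ means first $f$, then $g$). **Relations and factorizations.** A *relation on an object* $X$ of a category is a diagram consisting of $\eta_X: X\to\Psi X$ and $\epsilon_0,\epsilon_1:\Psi X\rightrightarrows X$ with $\epsilon_0\eta_X=\epsilon_1\eta_X=1_X$. A *relation* $R$ on a category consists of a relation on each object $X$ together with, for each morphism $f:X\to Y$, a morphism $\Psi f:\Psi X\to\Psi Y$ such that $\Psi f\,\eta_X=\eta_Y f$ and $\epsilon_i\,\Psi f=f\epsilon_i$ ($i=0,1$); $\Psi$ is not required to preserve identities or composition. A *factorization* $F$ on $\mathcal C$ consists of a factorization $X\xrightarrow{\lambda_f}\Phi f\xrightarrow{\rho_f}Y$ of each morphism $f:X\to Y$ together with, for each commutative square from $f$ to $g$, a compatible morphism $\Phi f\to\Phi g$ (again without functoriality). Put $$\mathrm{coalg}(F)=\{f:X\to Y\mid \exists\, s:Y\to\Phi f,\ sf=\lambda_f,\ \rho_f s=1_Y\},\qquad \mathrm{alg}(F)=\{f:X\to Y\mid\exists\, s:\Phi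 f\to X,\ s\lambda_f=1_X,\ fs=\rho_f\}.$$ $F$ is a *weak factorization structure* if $\lambda_f\in\mathrm{coalg}(F)$ and $\rho_f\in\mathrm{alg}(F)$ for all $f$. A relation $R$ on $\mathcal C$ yields a factorization $F(R)$ sending $f:X\to Y$ to $$X\xrightarrow{\lambda_f=(1_X,\eta_Y f)}Mf=X\times_Y\Psi Y\xrightarrow{\rho_f=\epsilon_1\pi_{\Psi Y}}Y,$$ where the pullback is that of $f$ and $\epsilon_0$, and sending a square $(\alpha,\beta)$ to $\alpha\times\Psi\beta$. We say that $R$ *generates* $(\mathsf L,\mathsf R)$ if $\mathrm{coalg}(F(R))=\mathsf L$ and $\mathrm{alg}(F(R))=\mathsf R$. **Display maps and identity types.** A class $\mathsf D$ of morphisms makes $(\mathcal C,\mathsf D)$ a *display map category* if $\mathsf D$ contains all isomorphisms and all morphisms to terminal objects and is stable under pullback; it *models $\Sigma$-types* if $\mathsf D$ is closed under composition. For $f:X\to Y$, an *identity type of $f$* is a relation $X\xrightarrow{r}\mathrm{Id}(f)\rightrightarrows X$ on $f$ in the slice $\mathcal C/Y$ such that the induced map $\epsilon=(\epsilon_0,\epsilon_1):\mathrm{Id}(f)\to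 X\times_Y X$ is in $\mathsf D$ and such that, for every $\alpha:A\to X$ in $\mathcal C$ and $i=0,1$, the morphism $\alpha^*r=(1_A,r\alpha):A\to A\times_X\mathrm{Id}(f)$ (pullback of $\alpha$ and $\epsilon_i$) has the left lifting property against every morphism of $\mathsf D$. An identity type of an object $X$ is an identity type of $X\to *$ with $*$ terminal, that is, a relation on $X$ satisfying these conditions with $X\times X$ in place of $X\times_Y X$. $(\mathcal C,\mathsf D)$ *models $\mathrm{Id}$-types* if each slice $\mathcal C/Y$ carries a relation whose value at every $f:X\to Y$ in $\mathsf D$ is an identity type of $f$. A relation $I$ on $\mathcal C$ is an *$\mathrm{Id}$-presentation* of $(\mathsf L,\mathsf R)$ if $F(I)$ is a weak factorization structure, $I$ generates $(\mathsf L,\mathsf R)$, and $I(X)$ is an identity type of $X$ with respect to $\mathrm{alg}(F(I))$ for each object $X$. **Moore relation systems.** A relation $R$ on $\mathcal C$ is a *Moore relation system* if it is: * *transitive*: for each $X$ there is $\mu_X:\Psi X\,{}_{\epsilon_1}\!\times_{\epsilon_0}\Psi X\to\Psi X$ with $\epsilon_0\mu_X=\epsilon_0\pi_0$, $\epsilon_1\mu_X=\epsilon_1\pi_1$,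 $\mu_X(1,\eta\epsilon_1)=1$; * *symmetric*: for each $X$ there is $\nu_X:\Psi X\,{}_{\epsilon_0}\!\times_{\epsilon_0}\Psi X\to\Psi X$ with $\epsilon_0\nu_X=\epsilon_1\pi_0$, $\epsilon_1\nu_X=\epsilon_1\pi_1$, $\nu_X(\eta\epsilon_0,1)=1$; * *homotopical*: for each $X$ there are an object $\Psi^\square X$ and morphisms $\eta^\square:X\to\Psi^\square X$, $\;e_0,e_1,\zeta:\Psi^\square X\to\Psi X$, $\;\delta_X:\Psi X\to\Psi^\square X$ with $$e_0\eta^\square=e_1\eta^\square=\zeta\eta^\square=\eta,\quad \epsilon_0e_i=\epsilon_i\zeta\ (i=0,1),\quad \delta\eta=\eta^\square,\quad e_0\delta=\zeta\delta=\eta\epsilon_0,\quad e_1\delta=1,$$ and for each $f:X\to Y$ a morphism $\tau_f:X\,{}_{\eta f}\!\times_{\zeta}\Psi^\square Y\to\Psi(X\,{}_{f}\!\times_{\epsilon_0}\Psi Y)$ with $\tau_f(1,\eta^\square f)=\eta(1,\eta f)$ and $\epsilon_i\tau_f=1_X\times e_i$ for $i=0,1$. **Theorem.** The following are equivalent: 1.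 $(\mathsf L,\mathsf R)$ has an $\mathrm{Id}$-presentation; 2. $(\mathsf L,\mathsf R)$ is *type-theoretic*: every morphism to a terminal object is in $\mathsf R$, and $\mathsf L$ is stable under pullback along morphisms of $\mathsf R$; 3. $(\mathsf L,\mathsf R)$ is generated by a Moore relation system; 4. $(\mathcal C,\mathsf R)$ is a display map category modeling $\Sigma$- and $\mathrm{Id}$-types. -/

import Mathlib

open CategoryTheory CategoryTheory.Limits

universe v u

namespace TypeTheoreticWFS

/-! ### Relations and factorizations -/

section Basic

variable {C : Type u} [Category.{v} C]

/-- A relation on an object `X` (an internal reflexive pseudo-relation): a diagram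
`X ⟶ Ψ ⇉ X` in which `η : X ⟶ Ψ` is a common section of `ε₀, ε₁ : Ψ ⟶ X`. -/
structure RelationOn (X : C) where
  Ψ : C
  η : X ⟶ Ψ
  ε₀ : Ψ ⟶ X
  ε₁ : Ψ ⟶ X
  η_ε₀ : η ≫ ε₀ = 𝟙 X
  η_ε₁ : η ≫ ε₁ = 𝟙 X

variable (C) in
/-- A relation on a category: a relation on every object and, for every morphism `f`, a morphism
of diagrams lying over `f`. No compatibility with identities or composition is required
(these are sections in the category of categories and "afunctors"). -/
structure CatRelation where
  on : ∀ X : C, RelationOn X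
  map : ∀ {X Y : C}, (X ⟶ Y) → ((on X).Ψ ⟶ (on Y).Ψ)
  η_map : ∀ {X Y : C} (f : X ⟶ Y), (on X).η ≫ map f = f ≫ (on Y).η
  map_ε₀ : ∀ {X Y : C} (f : X ⟶ Y), map f ≫ (on Y).ε₀ = (on X).ε₀ ≫ f
  map_ε₁ : ∀ {X Y : C} (f : X ⟶ Y), map f ≫ (on Y).ε₁ = (on X).ε₁ ≫ f

/-- A factorization `X ⟶ Φ ⟶ Y` of a morphism `f : X ⟶ Y`. -/
structure FactorizationOf {X Y : C} (f : X ⟶ Y) where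
  Φ : C
  lam : X ⟶ Φ
  rho : Φ ⟶ Y
  fac : lam ≫ rho = f

variable (C) in
/-- A factorization on a category: a factorization of every morphism and, for every commutative
square, a morphism between the middle objects compatible with the square.
No functoriality is required. -/
structure CatFactorization where
  on : ∀ {X Y : C} (f : X ⟶ Y), FactorizationOf f
  map : ∀ {X Y W Z : C} {f : X ⟶ Y} {g : W ⟶ Z} (α : X ⟶ W) (β : Y ⟶ Z),
    α ≫ g = f ≫ β → ((on f).Φ ⟶ (on g).Φ)
  lam_map : ∀ {X Y W Z : C} {f : X ⟶ Y} {g : W ⟶ Z} (α : X ⟶ W) (β : Y ⟶ Z)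
    (h : α ≫ g = f ≫ β), (on f).lam ≫ map α β h = α ≫ (on g).lam
  map_rho : ∀ {X Y W Z : C} {f : X ⟶ Y} {g : W ⟶ Z} (α : X ⟶ W) (β : Y ⟶ Z)
    (h : α ≫ g = f ≫ β), map α β h ≫ (on g).rho = (on f).rho ≫ β

namespace CatFactorization

/-- The morphisms `f : X ⟶ Y` with a coalgebra structure `s : Y ⟶ Φ f`. -/
def coalg (F : CatFactorization C) : MorphismProperty C := fun _ Y f =>
  ∃ s : Y ⟶ (F.on f).Φ, f ≫ s = (F.on f).lam ∧ s ≫ (F.on f).rho = 𝟙 Y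

/-- The morphisms `f : X ⟶ Y` with an algebra structure `s : Φ f ⟶ X`. -/
def alg (F : CatFactorization C) : MorphismProperty C := fun X _ f =>
  ∃ s : (F.on f).Φ ⟶ X, (F.on f).lam ≫ s = 𝟙 X ∧ s ≫ f = (F.on f).rho

/-- `F` is a weak factorization structure: every left factor is a coalgebra and every right factor
is an algebra. -/
def IsWeakFactorizationStructure (F : CatFactorization C) : Prop :=
  ∀ {X Y : C} (f : X ⟶ Y), F.coalg (F.on f).lam ∧ F.alg (F.on f).rho

/-- `(L, R)` is the pair of classes `(coalg F, alg F)` generated by the factorization `F`. -/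
def Generates (F : CatFactorization C) (L R : MorphismProperty C) : Prop :=
  F.coalg = L ∧ F.alg = R

end CatFactorization

/-- The pullback `α^* r : A ⟶ A ×_X E`, along `α : A ⟶ X`, of a section `r` of `e : E ⟶ X`
(regarded as a morphism over `X` from `𝟙 X` to `e`). -/
noncomputable def pullbackSection [HasPullbacks C] {A X E : C} (α : A ⟶ X) (r : X ⟶ E)
    (e : E ⟶ X) (h : r ≫ e = 𝟙 X) : A ⟶ pullback α e :=
  pullback.lift (𝟙 A) (α ≫ r) (by simp [h])

namespace CatRelation

variable [HasPullbacks C]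

/-- The object `X ×_Y Ψ Y`, the pullback of `f : X ⟶ Y` and `ε₀ : Ψ Y ⟶ Y`. -/
noncomputable abbrev pathObj (R : CatRelation C) {X Y : C} (f : X ⟶ Y) : C :=
  pullback f (R.on Y).ε₀

/-- The morphism `1 × η f : X ⟶ X ×_Y Ψ Y`. -/
noncomputable def pathLam (R : CatRelation C) {X Y : C} (f : X ⟶ Y) : X ⟶ R.pathObj f :=
  pullback.lift (𝟙 X) (f ≫ (R.on Y).η) (by
    rw [Category.assoc, (R.on Y).η_ε₀, Category.id_comp, Category.comp_id])

/-- The morphism `ε₁ π : X ×_Y Ψ Y ⟶ Y`. -/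
noncomputable def pathRho (R : CatRelation C) {X Y : C} (f : X ⟶ Y) : R.pathObj f ⟶ Y :=
  pullback.snd f (R.on Y).ε₀ ≫ (R.on Y).ε₁

/-- The morphism `X ×_Y Ψ Y ⟶ W ×_Z Ψ Z` induced by a commutative square from `f` to `g`. -/
noncomputable def pathMap (R : CatRelation C) {X Y W Z : C} {f : X ⟶ Y} {g : W ⟶ Z}
    (α : X ⟶ W) (β : Y ⟶ Z) (h : α ≫ g = f ≫ β) : R.pathObj f ⟶ R.pathObj g :=
  pullback.lift (pullback.fst f (R.on Y).ε₀ ≫ α) (pullback.snd f (R.on Y).ε₀ ≫ R.map β) (by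
    rw [Category.assoc, Category.assoc, R.map_ε₀, h, ← Category.assoc, ← Category.assoc,
      pullback.condition])

theorem pathLam_fst (R : CatRelation C) {X Y : C} (f : X ⟶ Y) :
    R.pathLam f ≫ pullback.fst f (R.on Y).ε₀ = 𝟙 X :=
  pullback.lift_fst _ _ _

theorem pathLam_snd (R : CatRelation C) {X Y : C} (f : X ⟶ Y) :
    R.pathLam f ≫ pullback.snd f (R.on Y).ε₀ = f ≫ (R.on Y).η :=
  pullback.lift_snd _ _ _

theorem pathMap_fst (R : CatRelation C) {X Y W Z : C} {f : X ⟶ Y} {g : W ⟶ Z}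
    (α : X ⟶ W) (β : Y ⟶ Z) (h : α ≫ g = f ≫ β) :
    R.pathMap α β h ≫ pullback.fst g (R.on Z).ε₀ = pullback.fst f (R.on Y).ε₀ ≫ α :=
  pullback.lift_fst _ _ _

theorem pathMap_snd (R : CatRelation C) {X Y W Z : C} {f : X ⟶ Y} {g : W ⟶ Z}
    (α : X ⟶ W) (β : Y ⟶ Z) (h : α ≫ g = f ≫ β) :
    R.pathMap α β h ≫ pullback.snd g (R.on Z).ε₀ = pullback.snd f (R.on Y).ε₀ ≫ R.map β :=
  pullback.lift_snd _ _ _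

theorem pathLam_pathRho (R : CatRelation C) {X Y : C} (f : X ⟶ Y) :
    R.pathLam f ≫ R.pathRho f = f := by
  rw [pathRho, ← Category.assoc, pathLam_snd, Category.assoc, (R.on _).η_ε₁, Category.comp_id]

theorem pathLam_pathMap (R : CatRelation C) {X Y W Z : C} {f : X ⟶ Y} {g : W ⟶ Z}
    (α : X ⟶ W) (β : Y ⟶ Z) (h : α ≫ g = f ≫ β) :
    R.pathLam f ≫ R.pathMap α β h = α ≫ R.pathLam g := by
  apply pullback.hom_ext
  · rw [Category.assoc, Category.assoc, pathMap_fst, ← Category.assoc, pathLam_fst,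
      pathLam_fst, Category.id_comp, Category.comp_id]
  · rw [Category.assoc, Category.assoc, pathMap_snd, ← Category.assoc, pathLam_snd,
      pathLam_snd, Category.assoc, R.η_map, ← Category.assoc, ← h, Category.assoc]

theorem pathMap_pathRho (R : CatRelation C) {X Y W Z : C} {f : X ⟶ Y} {g : W ⟶ Z}
    (α : X ⟶ W) (β : Y ⟶ Z) (h : α ≫ g = f ≫ β) :
    R.pathMap α β h ≫ R.pathRho g = R.pathRho f ≫ β := by
  rw [pathRho, pathRho, ← Category.assoc, pathMap_snd, Category.assoc, R.map_ε₁, Category.assoc]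

/-- The factorization on `C` obtained from a relation on `C`: it sends `f : X ⟶ Y` to its mapping
path factorization `X ⟶ X ×_Y Ψ Y ⟶ Y`. -/
noncomputable def toFactorization (R : CatRelation C) : CatFactorization C where
  on f := ⟨R.pathObj f, R.pathLam f, R.pathRho f, R.pathLam_pathRho f⟩
  map α β h := R.pathMap α β h
  lam_map α β h := R.pathLam_pathMap α β h
  map_rho α β h := R.pathMap_pathRho α β h

end CatRelation

/-! ### Type-theoretic weak factorization systems and display map categories -/

/-- `X` is fibrant: every morphism from `X` to a terminal object is in `R`. -/
def IsFibrant (R : MorphismProperty C) (X : C) : Prop :=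
  ∀ {T : C}, IsTerminal T → ∀ f : X ⟶ T, R f

/-- The class `L` is stable under pullback along morphisms in `R`. -/
def IsStableUnderPullbackAlong (L R : MorphismProperty C) : Prop :=
  ∀ {P X A Y : C} {p : P ⟶ X} {q : P ⟶ A} {r : X ⟶ Y} {l : A ⟶ Y},
    IsPullback p q r l → L l → R r → L p

/-- `(L, R)` is type-theoretic. -/
structure IsTypeTheoretic (L R : MorphismProperty C) : Prop where
  fibrant : ∀ X : C, IsFibrant R X
  stable : IsStableUnderPullbackAlong L R

/-- `(C, D)` is a display map category. -/
structure IsDisplayMapCategory (D : MorphismProperty C) : Prop where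
  of_isIso : ∀ {X Y : C} (f : X ⟶ Y), IsIso f → D f
  to_terminal : ∀ {X T : C}, IsTerminal T → ∀ f : X ⟶ T, D f
  pullback : D.IsStableUnderBaseChange

/-- `(C, D)` models `Σ`-types: `D` is closed under composition. -/
def ModelsSigmaTypes (D : MorphismProperty C) : Prop :=
  ∀ {X Y Z : C} (f : X ⟶ Y) (g : Y ⟶ Z), D f → D g → D (f ≫ g)

/-! ### Identity types -/

/-- An identity type of an object `X` (equivalently, of `X ⟶ *` in the slice over a terminal
object `*`): a relation on `X` such that `(ε₀, ε₁) : Ψ ⟶ X × X` is a display map and all pullbacks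
`α^* η`, formed with respect to `ε₀` or to `ε₁`, have the left lifting property against the
display maps. -/
def IsIdentityTypeOfObject [HasPullbacks C] [HasBinaryProducts C] (D : MorphismProperty C) {X : C}
    (I : RelationOn X) : Prop :=
  D (prod.lift I.ε₀ I.ε₁) ∧
  ∀ {A : C} (α : A ⟶ X),
    D.llp (pullbackSection α I.η I.ε₀ I.η_ε₀) ∧ D.llp (pullbackSection α I.η I.ε₁ I.η_ε₁)

/-- An identity type of `f : X ⟶ Y`: a relation on `f` in the slice over `Y` such that
`(ε₀, ε₁) : Id(f) ⟶ X ×_Y X` is a display map and, for every morphism `α : A ⟶ X` of `C`, the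
pullbacks `α^* η`, formed with respect to `ε₀` or to `ε₁`, have the left lifting property against
the display maps. -/
def IsIdentityType [HasPullbacks C] (D : MorphismProperty C) {X Y : C} (f : X ⟶ Y)
    (I : RelationOn (Over.mk f)) : Prop :=
  D (pullback.lift (f := f) (g := f) I.ε₀.left I.ε₁.left
    ((Over.w I.ε₀).trans (Over.w I.ε₁).symm)) ∧
  ∀ {A : C} (α : A ⟶ X),
    D.llp (pullbackSection α I.η.left I.ε₀.left (congrArg CommaMorphism.left I.η_ε₀)) ∧
    D.llp (pullbackSection α I.η.left I.ε₁.left (congrArg CommaMorphism.left I.η_ε₁))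

/-- `I` is a model of `Id`-types of objects in `(C, D)`. -/
def IsModelOfIdTypesOfObjects [HasPullbacks C] [HasBinaryProducts C] (D : MorphismProperty C)
    (I : CatRelation C) : Prop :=
  ∀ X : C, IsIdentityTypeOfObject D (I.on X)

/-- `(C, D)` models `Id`-types: every slice `C / Y` carries a relation whose value at each display
map `f : X ⟶ Y` is an identity type of `f`. -/
def ModelsIdTypes [HasPullbacks C] (D : MorphismProperty C) : Prop :=
  ∃ I : ∀ Y : C, CatRelation (Over Y),
    ∀ {X Y : C} (f : X ⟶ Y), D f → IsIdentityType D f ((I Y).on (Over.mk f))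

/-- `I` is an `Id`-presentation of the weak factorization system `(L, R)`: the factorization
obtained from `I` is a weak factorization structure generating `(L, R)`, and `I` is a model of
`Id`-types of objects with respect to its class of algebras. -/
structure IsIdPresentation [HasPullbacks C] [HasBinaryProducts C] (I : CatRelation C)
    (L R : MorphismProperty C) : Prop where
  isWeakFactorizationStructure : I.toFactorization.IsWeakFactorizationStructure
  generates : I.toFactorization.Generates L R
  isModel : IsModelOfIdTypesOfObjects I.toFactorization.alg I

end Basic

/-! ### Moore relation systems -/

section Moore

variable {C : Type u} [Category.{v} C] [HasPullbacks C]

/-- The structure making a relation transitive. -/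
structure TransitiveStructure (R : CatRelation C) where
  μ : ∀ X : C, pullback (R.on X).ε₁ (R.on X).ε₀ ⟶ (R.on X).Ψ
  μ_ε₀ : ∀ X : C, μ X ≫ (R.on X).ε₀ = pullback.fst (R.on X).ε₁ (R.on X).ε₀ ≫ (R.on X).ε₀
  μ_ε₁ : ∀ X : C, μ X ≫ (R.on X).ε₁ = pullback.snd (R.on X).ε₁ (R.on X).ε₀ ≫ (R.on X).ε₁
  unit_μ : ∀ X : C,
    pullback.lift (𝟙 (R.on X).Ψ) ((R.on X).ε₁ ≫ (R.on X).η) (by simp [(R.on X).η_ε₀]) ≫ μ X =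
      𝟙 (R.on X).Ψ

/-- The structure making a relation symmetric. -/
structure SymmetricStructure (R : CatRelation C) where
  ν : ∀ X : C, pullback (R.on X).ε₀ (R.on X).ε₀ ⟶ (R.on X).Ψ
  ν_ε₀ : ∀ X : C, ν X ≫ (R.on X).ε₀ = pullback.fst (R.on X).ε₀ (R.on X).ε₀ ≫ (R.on X).ε₁
  ν_ε₁ : ∀ X : C, ν X ≫ (R.on X).ε₁ = pullback.snd (R.on X).ε₀ (R.on X).ε₀ ≫ (R.on X).ε₁
  unit_ν : ∀ X : C,
    pullback.lift ((R.on X).ε₀ ≫ (R.on X).η) (𝟙 (R.on X).Ψ) (by simp [(R.on X).η_ε₀]) ≫ ν X =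
      𝟙 (R.on X).Ψ

/-- The objects `Ψ^□ X` of a homotopical structure, written `sq X`, with the morphisms
`X ⟶ Ψ^□ X` (here `sqη`), `ε₀, ε₁, ζ : Ψ^□ X ⟶ Ψ X` (here `e₀, e₁, ζ`) and
`δ : Ψ X ⟶ Ψ^□ X`. -/
structure SquareStructure (R : CatRelation C) where
  sq : C → C
  sqη : ∀ X : C, X ⟶ sq X
  e₀ : ∀ X : C, sq X ⟶ (R.on X).Ψ
  e₁ : ∀ X : C, sq X ⟶ (R.on X).Ψ
  ζ : ∀ X : C, sq X ⟶ (R.on X).Ψ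
  δ : ∀ X : C, (R.on X).Ψ ⟶ sq X
  sqη_e₀ : ∀ X : C, sqη X ≫ e₀ X = (R.on X).η
  sqη_e₁ : ∀ X : C, sqη X ≫ e₁ X = (R.on X).η
  sqη_ζ : ∀ X : C, sqη X ≫ ζ X = (R.on X).η
  e₀_ε₀ : ∀ X : C, e₀ X ≫ (R.on X).ε₀ = ζ X ≫ (R.on X).ε₀
  e₁_ε₀ : ∀ X : C, e₁ X ≫ (R.on X).ε₀ = ζ X ≫ (R.on X).ε₁
  η_δ : ∀ X : C, (R.on X).η ≫ δ X = sqη X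
  δ_e₀ : ∀ X : C, δ X ≫ e₀ X = (R.on X).ε₀ ≫ (R.on X).η
  δ_ζ : ∀ X : C, δ X ≫ ζ X = (R.on X).ε₀ ≫ (R.on X).η
  δ_e₁ : ∀ X : C, δ X ≫ e₁ X = 𝟙 (R.on X).Ψ

namespace SquareStructure

variable {R : CatRelation C} (S : SquareStructure R)

/-- The pullback of `η f : X ⟶ Ψ Y` and `ζ : Ψ^□ Y ⟶ Ψ Y`. -/
noncomputable abbrev dom {X Y : C} (f : X ⟶ Y) : C := pullback (f ≫ (R.on Y).η) (S.ζ Y)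

/-- The morphism `1 × η f : X ⟶ X ×_{Ψ Y} Ψ^□ Y`. -/
noncomputable def unit {X Y : C} (f : X ⟶ Y) : X ⟶ S.dom f :=
  pullback.lift (𝟙 X) (f ≫ S.sqη Y) (by simp [S.sqη_ζ])

/-- The morphism `1 × ε₀ : X ×_{Ψ Y} Ψ^□ Y ⟶ X ×_Y Ψ Y`. -/
noncomputable def face₀ {X Y : C} (f : X ⟶ Y) : S.dom f ⟶ R.pathObj f :=
  pullback.lift (pullback.fst _ _) (pullback.snd _ _ ≫ S.e₀ Y) (by
    rw [Category.assoc, S.e₀_ε₀, ← pullback.condition_assoc, Category.assoc, (R.on Y).η_ε₀,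
      Category.comp_id])

/-- The morphism `1 × ε₁ : X ×_{Ψ Y} Ψ^□ Y ⟶ X ×_Y Ψ Y`. -/
noncomputable def face₁ {X Y : C} (f : X ⟶ Y) : S.dom f ⟶ R.pathObj f :=
  pullback.lift (pullback.fst _ _) (pullback.snd _ _ ≫ S.e₁ Y) (by
    rw [Category.assoc, S.e₁_ε₀, ← pullback.condition_assoc, Category.assoc, (R.on Y).η_ε₁,
      Category.comp_id])

end SquareStructure

/-- The structure making a relation homotopical. -/
structure HomotopicalStructure (R : CatRelation C) extends SquareStructure R where
  τ : ∀ {X Y : C} (f : X ⟶ Y), toSquareStructure.dom f ⟶ (R.on (R.pathObj f)).Ψ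
  unit_τ : ∀ {X Y : C} (f : X ⟶ Y),
    toSquareStructure.unit f ≫ τ f = R.pathLam f ≫ (R.on (R.pathObj f)).η
  τ_ε₀ : ∀ {X Y : C} (f : X ⟶ Y),
    τ f ≫ (R.on (R.pathObj f)).ε₀ = toSquareStructure.face₀ f
  τ_ε₁ : ∀ {X Y : C} (f : X ⟶ Y),
    τ f ≫ (R.on (R.pathObj f)).ε₁ = toSquareStructure.face₁ f

/-- A Moore relation system: a transitive, homotopical and symmetric relation. -/
structure IsMooreRelationSystem (R : CatRelation C) : Prop where
  transitive : Nonempty (TransitiveStructure R)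
  homotopical : Nonempty (HomotopicalStructure R)
  symmetric : Nonempty (SymmetricStructure R)

end Moore

end TypeTheoreticWFS

/-! The coalgebras of a mapping path factorization are the strong deformation retracts
(`CatRelation.coalg_iff`). Stability of `L` under pullback along `r` in `R` therefore follows from
path lifting: if paths of `Y` ending at `r x` lift to paths of `X` ending at `x`, trivial ones to
trivial ones, then the retraction and its homotopy lift to the pullback
(`isTypeTheoretic_of_transport`). Both kinds of presentation supply such lifts. With identity types,
one lifting problem against `r` gives the start of the lifted path and one against `(ε₀, ε₁)` gives
the path. With Moore relations, the algebra structure transports points forwards, the homotopical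
structure supplies the connecting path, and symmetry reverses directions.

Conversely, in a type-theoretic system an `(L, R)`-factorization of the diagonal of `f` in `R` is an
identity type of `f`. The delicate point is that its reflexivity section stays in `L` after pullback
along an arbitrary `α`; this is proved by factoring `α` itself
(`IsTypeTheoretic.pullbackSection_mem`). Restricted to the slice over the terminal object, identity
types make every mapping path factorization an `(L, R)`-factorization
(`isIdPresentation_of_isModel`). The same relation is Moore: each operation is a path with
prescribed endpoints, extended along a unit map in `L` on which its value is prescribed. -/

namespace TypeTheoreticWFS

attribute [local simp] pullback.lift_fst pullback.lift_snd pullback.lift_fst_assoc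
  pullback.lift_snd_assoc prod.lift_fst prod.lift_snd prod.lift_fst_assoc prod.lift_snd_assoc

/-! ### Closure properties of the two classes, and the retract argument. -/

section WeakFactorizationSystem

variable {C : Type u} [Category.{v} C] {L R : MorphismProperty C}

section

variable [MorphismProperty.IsWeakFactorizationSystem L R]

theorem exists_lift_of_wfs (L R : MorphismProperty C)
    [MorphismProperty.IsWeakFactorizationSystem L R] {A B X Y : C} {i : A ⟶ B} {p : X ⟶ Y}
    (hi : L i) (hp : R p) (f : A ⟶ X) (g : B ⟶ Y) (w : f ≫ p = i ≫ g) :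
    ∃ l : B ⟶ X, i ≫ l = f ∧ l ≫ p = g := by
  have := MorphismProperty.hasLiftingProperty_of_wfs i p hi hp
  have sq : CommSq f i p g := ⟨w⟩
  exact ⟨sq.lift, sq.fac_left, sq.fac_right⟩

theorem left_comp (R : MorphismProperty C) [MorphismProperty.IsWeakFactorizationSystem L R]
    {X Y Z : C} {f : X ⟶ Y} {g : Y ⟶ Z} (hf : L f) (hg : L g) : L (f ≫ g) := by
  rw [← MorphismProperty.llp_eq_of_wfs L R] at *
  exact R.llp.comp_mem f g hf hg

theorem right_comp (L : MorphismProperty C) [MorphismProperty.IsWeakFactorizationSystem L R]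
    {X Y Z : C} {f : X ⟶ Y} {g : Y ⟶ Z} (hf : R f) (hg : R g) : R (f ≫ g) := by
  rw [← MorphismProperty.rlp_eq_of_wfs L R] at *
  exact L.rlp.comp_mem f g hf hg

theorem right_of_isIso (L R : MorphismProperty C)
    [MorphismProperty.IsWeakFactorizationSystem L R] {X Y : C} (f : X ⟶ Y) [IsIso f] : R f := by
  rw [← MorphismProperty.rlp_eq_of_wfs L R]
  exact MorphismProperty.rlp_of_isIso _ f

theorem right_isStableUnderBaseChange (L R : MorphismProperty C)
    [MorphismProperty.IsWeakFactorizationSystem L R] : R.IsStableUnderBaseChange := by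
  rw [← MorphismProperty.rlp_eq_of_wfs L R]
  infer_instance

theorem right_of_isPullback (L : MorphismProperty C)
    [MorphismProperty.IsWeakFactorizationSystem L R] {P X Y Z : C} {fst : P ⟶ X} {snd : P ⟶ Y}
    {f : X ⟶ Z} {g : Y ⟶ Z} (sq : IsPullback fst snd f g) (hg : R g) : R fst :=
  (right_isStableUnderBaseChange L R).of_isPullback sq.flip hg

theorem right_pullback_fst (L : MorphismProperty C)
    [MorphismProperty.IsWeakFactorizationSystem L R] {X Y Z : C} (f : X ⟶ Z) (g : Y ⟶ Z)
    [HasPullback f g] (hg : R g) : R (pullback.fst f g) :=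
  right_of_isPullback L (IsPullback.of_hasPullback f g) hg

theorem right_pullback_snd (L : MorphismProperty C)
    [MorphismProperty.IsWeakFactorizationSystem L R] {X Y Z : C} (f : X ⟶ Z) (g : Y ⟶ Z)
    [HasPullback f g] (hf : R f) : R (pullback.snd f g) :=
  right_of_isPullback L (IsPullback.of_hasPullback f g).flip hf

/-- The left class contains every retract, under the source, of one of its members. -/
theorem left_of_retract (R : MorphismProperty C)
    [MorphismProperty.IsWeakFactorizationSystem L R] {X Y Z : C} {f : X ⟶ Y} {g : X ⟶ Z}
    (hg : L g) (i : Y ⟶ Z) (r : Z ⟶ Y) (hi : f ≫ i = g) (hr : g ≫ r = f) (hir : i ≫ r = 𝟙 Y) :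
    L f := by
  rw [← MorphismProperty.llp_eq_of_wfs L R] at *
  intro A B p hp
  refine ⟨fun {a b} sq => ?_⟩
  have := hg p hp
  have sq' : CommSq a g p (r ≫ b) := ⟨by rw [sq.w, ← hr, Category.assoc]⟩
  exact ⟨⟨⟨i ≫ sq'.lift, by rw [← Category.assoc, hi, sq'.fac_left],
    by rw [Category.assoc, sq'.fac_right, ← Category.assoc, hir, Category.id_comp]⟩⟩⟩

end

/-- A factorization with left factors in `L` and right factors in `R` generates `(L, R)`. -/
theorem generates_of_mem [MorphismProperty.IsWeakFactorizationSystem L R]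
    (F : CatFactorization C) (hl : ∀ {X Y : C} (f : X ⟶ Y), L (F.on f).lam)
    (hr : ∀ {X Y : C} (f : X ⟶ Y), R (F.on f).rho) : F.Generates L R := by
  constructor
  · ext X Y f
    constructor
    · rintro ⟨s, hs, hs'⟩
      exact left_of_retract R (hl f) s (F.on f).rho hs (F.on f).fac hs'
    · intro hf
      exact exists_lift_of_wfs L R hf (hr f) _ _ (by rw [(F.on f).fac, Category.comp_id])
  · ext X Y f
    constructor
    · rintro ⟨s, hs, hs'⟩
      have hf := hr f
      rw [← MorphismProperty.rlp_eq_of_wfs L R] at hf ⊢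
      intro A B i hi
      refine ⟨fun {a b} sq => ?_⟩
      have := hf i hi
      have sq' : CommSq (a ≫ (F.on f).lam) i (F.on f).rho b :=
        ⟨by rw [Category.assoc, (F.on f).fac, sq.w]⟩
      exact ⟨⟨⟨sq'.lift ≫ s, by rw [← Category.assoc, sq'.fac_left, Category.assoc, hs,
        Category.comp_id], by rw [Category.assoc, hs', sq'.fac_right]⟩⟩⟩
    · intro hf
      exact exists_lift_of_wfs L R (hl f) hf _ _ (by rw [(F.on f).fac, Category.id_comp])

end WeakFactorizationSystem

/-! ### Pulling back sections along arbitrary morphisms. -/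

section Sections

variable {C : Type u} [Category.{v} C] [HasFiniteLimits C] {L R : MorphismProperty C}
  [MorphismProperty.IsWeakFactorizationSystem L R]

theorem pullbackSection_fst {A X E : C} (α : A ⟶ X) (r : X ⟶ E) (e : E ⟶ X) (h : r ≫ e = 𝟙 X) :
    pullbackSection α r e h ≫ pullback.fst α e = 𝟙 A :=
  pullback.lift_fst _ _ _

theorem pullbackSection_snd {A X E : C} (α : A ⟶ X) (r : X ⟶ E) (e : E ⟶ X) (h : r ≫ e = 𝟙 X) :
    pullbackSection α r e h ≫ pullback.snd α e = α ≫ r :=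
  pullback.lift_snd _ _ _

/-- By pasting: next to the square defining `α ×_X E`, the outer rectangle has identities as
horizontal sides. -/
theorem isPullback_pullbackSection {A X E : C} (α : A ⟶ X) (r : X ⟶ E) (e : E ⟶ X)
    (h : r ≫ e = 𝟙 X) : IsPullback (pullbackSection α r e h) α (pullback.snd α e) r := by
  refine IsPullback.of_right (h₁₂ := pullback.fst α e) (h₂₂ := e) (v₁₃ := α) ?_
    (pullbackSection_snd α r e h) (IsPullback.of_hasPullback α e).flip.flip
  rw [pullbackSection_fst, h]
  exact IsPullback.of_horiz_isIso ⟨by simp⟩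

/-- If all objects are fibrant, the left class is closed under left cancellation. -/
theorem left_of_comp (hT : ∀ X : C, IsFibrant R X) {X Y Z : C} {f : X ⟶ Y} {g : Y ⟶ Z}
    (hg : L g) (hfg : L (f ≫ g)) : L f := by
  -- Fibrancy of `Y` yields a retraction `r` of `g`, which makes `f` a retract of `f ≫ g` under `X`.
  obtain ⟨r, hr, -⟩ := exists_lift_of_wfs L R hg (hT Y terminalIsTerminal (terminal.from Y))
    (𝟙 Y) (terminal.from Z) (Subsingleton.elim _ _)
  exact left_of_retract R hfg g r rfl (by rw [Category.assoc, hr, Category.comp_id]) hr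

/-- In a type-theoretic weak factorization system, a section in the left class of a morphism of
the right class remains in the left class after pulling back along any morphism. -/
theorem IsTypeTheoretic.pullbackSection_mem (hT : IsTypeTheoretic L R) {A X E : C} (α : A ⟶ X)
    {r : X ⟶ E} {e : E ⟶ X} (h : r ≫ e = 𝟙 X) (hr : L r) (he : R e) :
    L (pullbackSection α r e h) := by
  -- Write `α = i ≫ p` with `i` in `L` and `p` in `R`. Stability handles `p`. For `i`, cancellation
  -- applies: the section followed by the projection (a pullback of `i` along a map in `R`) equals
  -- `i` followed by the section over `Z`.
  obtain ⟨Z, i, p, rfl, hi, hp⟩ := MorphismProperty.factorizationData L R α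
  have h₁ : L (pullbackSection p r e h) :=
    hT.stable (isPullback_pullbackSection p r e h) hr (right_pullback_snd L p e hp)
  have he₁ : R (pullback.fst p e) := right_pullback_fst L p e he
  have h₂ : L (pullbackSection i _ _ (pullbackSection_fst p r e h)) := by
    refine left_of_comp hT.fibrant (g := pullback.snd i (pullback.fst p e)) ?_ ?_
    · exact hT.stable (IsPullback.of_hasPullback i (pullback.fst p e)).flip hi he₁
    · rw [pullbackSection_snd]
      exact left_comp R hi h₁
  -- The iterated pullback along `p` and then `i` is compared with the pullback along `i ≫ p`.
  refine left_of_retract R h₂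
    (pullback.lift (pullback.fst _ _) (pullback.lift (pullback.fst _ _ ≫ i) (pullback.snd _ _)
      (by rw [Category.assoc, pullback.condition])) (by rw [pullback.lift_fst]))
    (pullback.lift (pullback.fst _ _) (pullback.snd _ _ ≫ pullback.snd _ _)
      (by rw [pullback.condition_assoc, Category.assoc, pullback.condition])) ?_ ?_ ?_
  · ext <;> simp [pullbackSection]
  · ext <;> simp [pullbackSection]
  · ext <;> simp

end Sections

/-! ### Identity types from factored diagonals, and the presentation they give. -/

section IdentityTypes

variable {C : Type u} [Category.{v} C] [HasFiniteLimits C]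

section Slices

variable (L R : MorphismProperty C) [MorphismProperty.IsWeakFactorizationSystem L R]

/-- The relation on an object `f` of a slice given by an `(L, R)`-factorization of its
diagonal. -/
noncomputable def diagonalRelation {Y : C} (f : Over Y) : RelationOn f :=
  let D := MorphismProperty.factorizationData L R (pullback.diagonal f.hom)
  { Ψ := Over.mk (D.p ≫ pullback.fst f.hom f.hom ≫ f.hom)
    η := Over.homMk D.i (by simp)
    ε₀ := Over.homMk (D.p ≫ pullback.fst f.hom f.hom)
    ε₁ := Over.homMk (D.p ≫ pullback.snd f.hom f.hom) (by simp [pullback.condition])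
    η_ε₀ := by ext; simp
    η_ε₁ := by ext; simp }

theorem diagonalRelation_η_mem {Y : C} (f : Over Y) : L (diagonalRelation L R f).η.left :=
  (MorphismProperty.factorizationData L R (pullback.diagonal f.hom)).hi

theorem diagonalRelation_ε_mem {Y : C} (f : Over Y) :
    R (pullback.lift (f := f.hom) (g := f.hom) (diagonalRelation L R f).ε₀.left
      (diagonalRelation L R f).ε₁.left
      ((Over.w (diagonalRelation L R f).ε₀).trans (Over.w (diagonalRelation L R f).ε₁).symm)) := by
  let D := MorphismProperty.factorizationData L R (pullback.diagonal f.hom)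
  have h : pullback.lift (f := f.hom) (g := f.hom) (diagonalRelation L R f).ε₀.left
      (diagonalRelation L R f).ε₁.left
      ((Over.w (diagonalRelation L R f).ε₀).trans (Over.w (diagonalRelation L R f).ε₁).symm) =
      D.p := by
    apply pullback.hom_ext
    · exact pullback.lift_fst _ _ _
    · exact pullback.lift_snd _ _ _
  rw [h]
  exact D.hp

theorem diagonalRelation_ε₀_mem {Y : C} (f : Over Y) (hf : R f.hom) :
    R (diagonalRelation L R f).ε₀.left := by
  have := right_comp L (diagonalRelation_ε_mem L R f) (right_pullback_fst L f.hom f.hom hf)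
  rwa [pullback.lift_fst] at this

theorem diagonalRelation_ε₁_mem {Y : C} (f : Over Y) (hf : R f.hom) :
    R (diagonalRelation L R f).ε₁.left := by
  have := right_comp L (diagonalRelation_ε_mem L R f) (right_pullback_snd L f.hom f.hom hf)
  rwa [pullback.lift_snd] at this

/-- A lift of `η`, in `L`, against `(ε₀, ε₁)`, in `R`; no functoriality is needed, so any lift will
do. -/
theorem exists_diagonalRelation_map {Y : C} {f g : Over Y} (φ : f ⟶ g) :
    ∃ m : (diagonalRelation L R f).Ψ ⟶ (diagonalRelation L R g).Ψ,
      (diagonalRelation L R f).η ≫ m = φ ≫ (diagonalRelation L R g).η ∧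
      m ≫ (diagonalRelation L R g).ε₀ = (diagonalRelation L R f).ε₀ ≫ φ ∧
      m ≫ (diagonalRelation L R g).ε₁ = (diagonalRelation L R f).ε₁ ≫ φ := by
  have hη₀ (f : Over Y) := congrArg CommaMorphism.left (diagonalRelation L R f).η_ε₀
  have hη₁ (f : Over Y) := congrArg CommaMorphism.left (diagonalRelation L R f).η_ε₁
  simp only [Over.comp_left, Over.id_left] at hη₀ hη₁
  obtain ⟨l, hl, hl'⟩ := exists_lift_of_wfs L R (diagonalRelation_η_mem L R f)
    (diagonalRelation_ε_mem L R g) (φ.left ≫ (diagonalRelation L R g).η.left)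
    (pullback.lift ((diagonalRelation L R f).ε₀.left ≫ φ.left)
      ((diagonalRelation L R f).ε₁.left ≫ φ.left) (by simp)) (by
      apply pullback.hom_ext
      · simp [hη₀, reassoc_of% hη₀]
      · simp [hη₁, reassoc_of% hη₁])
  have h₀ := congrArg (fun k => k ≫ pullback.fst _ _) hl'
  have h₁ := congrArg (fun k => k ≫ pullback.snd _ _) hl'
  simp only [Category.assoc, pullback.lift_fst, pullback.lift_snd] at h₀ h₁
  refine ⟨Over.homMk l ?_, ?_, ?_, ?_⟩
  · rw [← Over.w (diagonalRelation L R g).ε₀, reassoc_of% h₀, Over.w, Over.w]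
  · ext; exact hl
  · ext; exact h₀
  · ext; exact h₁

theorem IsTypeTheoretic.modelsIdTypes {L R : MorphismProperty C}
    [MorphismProperty.IsWeakFactorizationSystem L R] (hT : IsTypeTheoretic L R) :
    ModelsIdTypes R := by
  choose m hm₁ hm₂ hm₃ using fun (Y : C) (f g : Over Y) (φ : f ⟶ g) =>
    exists_diagonalRelation_map L R φ
  refine ⟨fun Y => ⟨fun f => diagonalRelation L R f, fun {f g} φ => m Y f g φ,
    fun {f g} φ => hm₁ Y f g φ, fun {f g} φ => hm₂ Y f g φ, fun {f g} φ => hm₃ Y f g φ⟩, ?_⟩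
  intro X Y f hf
  refine ⟨diagonalRelation_ε_mem L R (Over.mk f), fun α => ?_⟩
  rw [MorphismProperty.llp_eq_of_wfs L R]
  constructor
  · refine hT.pullbackSection_mem α _ (diagonalRelation_η_mem L R (Over.mk f)) ?_
    exact diagonalRelation_ε₀_mem L R (Over.mk f) hf
  · refine hT.pullbackSection_mem α _ (diagonalRelation_η_mem L R (Over.mk f)) ?_
    exact diagonalRelation_ε₁_mem L R (Over.mk f) hf

end Slices

/-- The relation on `C` underlying a relation on the slice over the terminal object. -/
noncomputable def CatRelation.ofTerminalSlice (I : CatRelation (Over (⊤_ C))) : CatRelation C where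
  on X :=
    { Ψ := (I.on (Over.mk (terminal.from X))).Ψ.left
      η := (I.on (Over.mk (terminal.from X))).η.left
      ε₀ := (I.on (Over.mk (terminal.from X))).ε₀.left
      ε₁ := (I.on (Over.mk (terminal.from X))).ε₁.left
      η_ε₀ := congrArg CommaMorphism.left (I.on (Over.mk (terminal.from X))).η_ε₀
      η_ε₁ := congrArg CommaMorphism.left (I.on (Over.mk (terminal.from X))).η_ε₁ }
  map {X Y} f := (I.map (Over.homMk f : Over.mk (terminal.from X) ⟶ Over.mk (terminal.from Y))).left
  η_map f := congrArg CommaMorphism.left (I.η_map (Over.homMk f : Over.mk (terminal.from _) ⟶ Over.mk (terminal.from _)))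
  map_ε₀ f := congrArg CommaMorphism.left (I.map_ε₀
    (Over.homMk f : Over.mk (terminal.from _) ⟶ Over.mk (terminal.from _)))
  map_ε₁ f := congrArg CommaMorphism.left (I.map_ε₁
    (Over.homMk f : Over.mk (terminal.from _) ⟶ Over.mk (terminal.from _)))

variable {L R : MorphismProperty C} [MorphismProperty.IsWeakFactorizationSystem L R]

/-- The fibre product over the terminal object is the product, so the two endpoint maps differ by an
isomorphism; the lifting conditions agree as they stand. -/
theorem isIdentityTypeOfObject_ofTerminalSlice (I : CatRelation (Over (⊤_ C))) (X : C)
    (h : IsIdentityType R (terminal.from X) (I.on (Over.mk (terminal.from X))))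
    (hR : R.RespectsIso) :
    IsIdentityTypeOfObject R ((CatRelation.ofTerminalSlice I).on X) := by
  refine ⟨?_, fun α => h.2 α⟩
  let e : pullback (terminal.from X) (terminal.from X) ⟶ X ⨯ X :=
    prod.lift (pullback.fst _ _) (pullback.snd _ _)
  have : IsIso e := ⟨pullback.lift prod.fst prod.snd (Subsingleton.elim _ _),
    by apply pullback.hom_ext <;> simp [e], by apply prod.hom_ext <;> simp [e]⟩
  have key : prod.lift (I.on (Over.mk (terminal.from X))).ε₀.left
      (I.on (Over.mk (terminal.from X))).ε₁.left = pullback.lift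
        (I.on (Over.mk (terminal.from X))).ε₀.left (I.on (Over.mk (terminal.from X))).ε₁.left
        (Subsingleton.elim _ _) ≫ e := by
    apply prod.hom_ext <;> simp [e]
  have he := MorphismProperty.RespectsIso.postcomp R e _ h.1
  exact key ▸ he

/-- The mapping path factorization of a model of identity types of objects is an
`(L, R)`-factorization. -/
theorem isIdPresentation_of_isModel (hT : ∀ X : C, IsFibrant R X) {I : CatRelation C}
    (hI : IsModelOfIdTypesOfObjects R I) : IsIdPresentation I L R := by
  have hl {X Y : C} (f : X ⟶ Y) : L (I.toFactorization.on f).lam := by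
    rw [← MorphismProperty.llp_eq_of_wfs L R]
    exact ((hI Y).2 f).1
  have hr {X Y : C} (f : X ⟶ Y) : R (I.toFactorization.on f).rho := by
    have hsnd : R (prod.snd : X ⨯ Y ⟶ Y) :=
      right_of_isPullback L (IsPullback.of_is_product (prodIsProd X Y) terminalIsTerminal).flip
        (hT X terminalIsTerminal _)
    -- `ρ` is `u` followed by the projection to `Y`, and `u` is the pullback of `(ε₀, ε₁)` along `f
    -- × 1`.
    let u : I.pathObj f ⟶ X ⨯ Y := prod.lift (pullback.fst _ _) (I.pathRho f)
    have sq : IsPullback u (pullback.snd f (I.on Y).ε₀) (prod.map f (𝟙 Y))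
        (prod.lift (I.on Y).ε₀ (I.on Y).ε₁) := by
      refine ⟨⟨?_⟩, ⟨PullbackCone.IsLimit.mk _
        (fun s => pullback.lift (s.fst ≫ prod.fst) s.snd ?_) (fun s => ?_) (fun s => ?_)
        fun s m hm hm' => ?_⟩⟩
      · apply prod.hom_ext
        · simp [u, pullback.condition]
        · simp [u, CatRelation.pathRho]
      · simpa using congrArg (fun k => k ≫ prod.fst) s.condition
      · apply prod.hom_ext
        · simp [u]
        · simpa [u, CatRelation.pathRho] using
            (congrArg (fun k => k ≫ prod.snd) s.condition).symm
      · simp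
      · apply pullback.hom_ext
        · simp [← hm, u]
        · simp [← hm']
    have := right_comp L (right_of_isPullback L sq (hI Y).1) hsnd
    rwa [prod.lift_snd] at this
  have hg := generates_of_mem (L := L) (R := R) I.toFactorization hl hr
  refine ⟨fun f => ?_, hg, ?_⟩
  · rw [hg.1, hg.2]
    exact ⟨hl f, hr f⟩
  · rwa [hg.2]

end IdentityTypes

/-! ### Path lifting implies stability; transport in Moore relation systems. -/

section Transport

variable {C : Type u} [Category.{v} C] [HasPullbacks C] {L R : MorphismProperty C}

theorem CatRelation.alg_iff (M : CatRelation C) {X Y : C} (f : X ⟶ Y) :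
    M.toFactorization.alg f ↔
      ∃ s : M.pathObj f ⟶ X, M.pathLam f ≫ s = 𝟙 X ∧ s ≫ f = M.pathRho f :=
  Iff.rfl

/-- The coalgebras of the mapping path factorization are the strong deformation retracts. -/
theorem CatRelation.coalg_iff (M : CatRelation C) {X Y : C} (f : X ⟶ Y) :
    M.toFactorization.coalg f ↔ ∃ (k : Y ⟶ X) (h : Y ⟶ (M.on Y).Ψ),
      f ≫ k = 𝟙 X ∧ f ≫ h = f ≫ (M.on Y).η ∧ h ≫ (M.on Y).ε₀ = k ≫ f ∧
        h ≫ (M.on Y).ε₁ = 𝟙 Y := by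
  have key : M.toFactorization.coalg f ↔
    ∃ s : Y ⟶ M.pathObj f, f ≫ s = M.pathLam f ∧ s ≫ M.pathRho f = 𝟙 Y := Iff.rfl
  rw [key]
  constructor
  · rintro ⟨s, hs, hs'⟩
    refine ⟨s ≫ pullback.fst _ _, s ≫ pullback.snd _ _, ?_, ?_, ?_, ?_⟩
    · rw [reassoc_of% hs, M.pathLam_fst]
    · rw [reassoc_of% hs, M.pathLam_snd]
    · simp [pullback.condition]
    · rw [Category.assoc]
      exact hs'
  · rintro ⟨k, h, hk, hh, h₀, h₁⟩
    refine ⟨pullback.lift k h h₀.symm, ?_, ?_⟩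
    · apply pullback.hom_ext
      · simp [hk, M.pathLam_fst]
      · simp [hh, M.pathLam_snd]
    · simp [CatRelation.pathRho, h₁]

/-- Suppose that a relation generates `(L, R)` and that, for each `r : X ⟶ Y` in `R`, the elements
of `X` can be transported backwards along the paths of `Y` by paths of `X`, which are trivial when
the given path is. Then `(L, R)` is type-theoretic. -/
theorem isTypeTheoretic_of_transport {M : CatRelation C} (hM : M.toFactorization.Generates L R)
    (hT : ∀ {X Y : C} (r : X ⟶ Y), R r → ∃ T : pullback r (M.on Y).ε₁ ⟶ (M.on X).Ψ,
      T ≫ (M.on X).ε₀ ≫ r = pullback.snd _ _ ≫ (M.on Y).ε₀ ∧ T ≫ (M.on X).ε₁ = pullback.fst _ _ ∧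
      pullbackSection r (M.on Y).η (M.on Y).ε₁ (M.on Y).η_ε₁ ≫ T = (M.on X).η) :
    IsTypeTheoretic L R where
  fibrant X Z hZ f := by
    rw [← hM.2]
    -- Over a terminal object the first projection is an algebra structure.
    exact ⟨pullback.fst _ _, M.pathLam_fst f, hZ.hom_ext _ _⟩
  stable := by
    intro P X A Y p q r l sq hl hr
    rw [← hM.1, M.coalg_iff] at hl ⊢
    obtain ⟨k, h, hk, hh, h₀, h₁⟩ := hl
    obtain ⟨T, hT₀, hT₁, hT₂⟩ := hT r hr
    -- `w` pairs `x` with the path `h (r x)` from `l (k (r x))` to `r x`. The start of its lift lies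
    -- over `l (k (r x))`, which defines the retraction `k'`; the lift itself is the homotopy.
    let w : X ⟶ pullback r (M.on Y).ε₁ := pullback.lift (𝟙 X) (r ≫ h) (by simp [h₁])
    have hw₁ : w ≫ pullback.fst _ _ = 𝟙 X := pullback.lift_fst _ _ _
    have hw₂ : w ≫ pullback.snd _ _ = r ≫ h := pullback.lift_snd _ _ _
    -- On `P` the path given by `h` is trivial, hence so is its lift.
    have hpw : p ≫ w = p ≫ pullbackSection r (M.on Y).η (M.on Y).ε₁ (M.on Y).η_ε₁ := by
      apply pullback.hom_ext
      · simp [hw₁, pullbackSection]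
      · simp [hw₂, pullbackSection, sq.w_assoc, hh]
    have hpwT : p ≫ w ≫ T = p ≫ (M.on X).η := by rw [reassoc_of% hpw, hT₂]
    let k' : X ⟶ P := sq.lift (w ≫ T ≫ (M.on X).ε₀) (r ≫ k)
      (by simp only [Category.assoc, hT₀, reassoc_of% hw₂, h₀])
    have hk₁ : k' ≫ p = w ≫ T ≫ (M.on X).ε₀ := sq.lift_fst _ _ _
    have hk₂ : k' ≫ q = r ≫ k := sq.lift_snd _ _ _
    refine ⟨k', w ≫ T, ?_, hpwT, by rw [hk₁, Category.assoc], by rw [Category.assoc, hT₁, hw₁]⟩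
    apply sq.hom_ext
    · rw [Category.assoc, hk₁, reassoc_of% hpwT, (M.on X).η_ε₀, Category.comp_id,
        Category.id_comp]
    · rw [Category.assoc, hk₂, sq.w_assoc, hk, Category.comp_id, Category.id_comp]

/-- Reversal of paths. -/
theorem SymmetricStructure.exists_reversal {M : CatRelation C} (S : SymmetricStructure M) (X : C) :
    ∃ ι : (M.on X).Ψ ⟶ (M.on X).Ψ, (M.on X).η ≫ ι = (M.on X).η ∧
      ι ≫ (M.on X).ε₀ = (M.on X).ε₁ ∧ ι ≫ (M.on X).ε₁ = (M.on X).ε₀ := by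
  refine ⟨pullback.lift (𝟙 _) ((M.on X).ε₀ ≫ (M.on X).η) (by simp [(M.on X).η_ε₀]) ≫ S.ν X,
    ?_, ?_, ?_⟩
  -- With both paths trivial, the two units of the pair coincide, so the unit law of `ν` applies.
  · have h := congrArg (fun k => (M.on X).η ≫ k) (S.unit_ν X)
    simp only [Category.comp_id] at h
    refine Eq.trans ?_ h
    simp only [← Category.assoc _ _ (S.ν X)]
    congr 1
    apply pullback.hom_ext <;> simp [reassoc_of% (M.on X).η_ε₀]
  · rw [Category.assoc, S.ν_ε₀, pullback.lift_fst_assoc, Category.id_comp]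
  · rw [Category.assoc, S.ν_ε₁, pullback.lift_snd_assoc, Category.assoc, (M.on X).η_ε₁,
      Category.comp_id]

/-- An algebra structure transports along paths, and a homotopical structure connects each element
to its transport. -/
theorem HomotopicalStructure.exists_transport {M : CatRelation C} (H : HomotopicalStructure M)
    {X Y : C} (r : X ⟶ Y) (hr : M.toFactorization.alg r) :
    ∃ T : M.pathObj r ⟶ (M.on X).Ψ, T ≫ (M.on X).ε₀ = pullback.fst _ _ ∧
      T ≫ (M.on X).ε₁ ≫ r = M.pathRho r ∧ M.pathLam r ≫ T = (M.on X).η := by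
  obtain ⟨s, hs, hs'⟩ := (M.alg_iff r).1 hr
  -- For a path `γ` from `r x`, the square `δ γ` has trivial base and runs from the trivial path to
  -- `γ`. Thus `τ` gives a path from `(x, η (r x))` to `(x, γ)`, and `M.map s` sends it to a path
  -- from `x` to its transport.
  let d : M.pathObj r ⟶ H.dom r := pullback.lift (pullback.fst _ _) (pullback.snd _ _ ≫ H.δ Y)
    (by rw [Category.assoc, H.δ_ζ, pullback.condition_assoc])
  have hd₁ : d ≫ pullback.fst _ _ = pullback.fst _ _ := pullback.lift_fst _ _ _
  have hd₂ : d ≫ pullback.snd _ _ = pullback.snd _ _ ≫ H.δ Y := pullback.lift_snd _ _ _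
  have h₀ : d ≫ H.face₀ r = pullback.fst _ _ ≫ M.pathLam r := by
    apply pullback.hom_ext
    · simp [SquareStructure.face₀, hd₁, M.pathLam_fst]
    · simp [SquareStructure.face₀, reassoc_of% hd₂, M.pathLam_snd, H.δ_e₀,
        pullback.condition_assoc]
  have h₁ : d ≫ H.face₁ r = 𝟙 _ := by
    apply pullback.hom_ext
    · simp [SquareStructure.face₁, hd₁]
    · simp [SquareStructure.face₁, reassoc_of% hd₂, H.δ_e₁]
  have hu : M.pathLam r ≫ d = H.unit r := by
    apply pullback.hom_ext
    · simp [SquareStructure.unit, hd₁, M.pathLam_fst]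
    · simp [SquareStructure.unit, hd₂, reassoc_of% M.pathLam_snd, H.η_δ]
  refine ⟨d ≫ H.τ r ≫ M.map s, ?_, ?_, ?_⟩
  · rw [Category.assoc, Category.assoc, M.map_ε₀, reassoc_of% H.τ_ε₀ r, reassoc_of% h₀, hs,
      Category.comp_id]
  · rw [Category.assoc, Category.assoc, reassoc_of% M.map_ε₁, reassoc_of% H.τ_ε₁ r,
      reassoc_of% h₁, hs']
  · rw [reassoc_of% hu, reassoc_of% H.unit_τ r, M.η_map, reassoc_of% hs]

/-- Reverse the path in `Y`, transport forwards, then reverse the connecting path in `X`. -/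
theorem IsMooreRelationSystem.isTypeTheoretic {M : CatRelation C} (hM : IsMooreRelationSystem M)
    (hg : M.toFactorization.Generates L R) : IsTypeTheoretic L R := by
  obtain ⟨H⟩ := hM.homotopical
  obtain ⟨S⟩ := hM.symmetric
  refine isTypeTheoretic_of_transport hg fun {X Y} r hr => ?_
  rw [← hg.2] at hr
  obtain ⟨T, hT₀, hT₁, hT₂⟩ := H.exists_transport r hr
  obtain ⟨ι, hι, hι₀, hι₁⟩ := S.exists_reversal X
  obtain ⟨κ, hκ, hκ₀, hκ₁⟩ := S.exists_reversal Y
  let c : pullback r (M.on Y).ε₁ ⟶ M.pathObj r :=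
    pullback.lift (pullback.fst _ _) (pullback.snd _ _ ≫ κ)
      (by rw [Category.assoc, hκ₀, pullback.condition])
  refine ⟨c ≫ T ≫ ι, ?_, ?_, ?_⟩
  · simp only [Category.assoc, reassoc_of% hι₀, hT₁, CatRelation.pathRho, c,
      pullback.lift_snd_assoc, hκ₁]
  · simp only [Category.assoc, hι₁, hT₀, c, pullback.lift_fst]
  · have : pullbackSection r (M.on Y).η (M.on Y).ε₁ (M.on Y).η_ε₁ ≫ c = M.pathLam r := by
      apply pullback.hom_ext
      · simp [c, pullbackSection, CatRelation.pathLam]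
      · simp [c, pullbackSection, CatRelation.pathLam, hκ]
    rw [reassoc_of% this, reassoc_of% hT₂, hι]

end Transport

/-! ### Identity types supply path lifting and Moore operations. -/

section IdPresentation

variable {C : Type u} [Category.{v} C] [HasFiniteLimits C] {L R : MorphismProperty C}
  [MorphismProperty.IsWeakFactorizationSystem L R]

/-- A homotopy between given maps can be extended along a morphism of the left class. -/
theorem exists_path_lift {X : C} {I : RelationOn X} (hI : IsIdentityTypeOfObject R I) {A B : C}
    {i : A ⟶ B} (hi : L i) (h : A ⟶ I.Ψ) (g₀ g₁ : B ⟶ X) (h₀ : h ≫ I.ε₀ = i ≫ g₀)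
    (h₁ : h ≫ I.ε₁ = i ≫ g₁) :
    ∃ l : B ⟶ I.Ψ, i ≫ l = h ∧ l ≫ I.ε₀ = g₀ ∧ l ≫ I.ε₁ = g₁ := by
  obtain ⟨l, hl, hl'⟩ := exists_lift_of_wfs L R hi hI.1 h (prod.lift g₀ g₁)
    (by apply prod.hom_ext <;> simp [h₀, h₁])
  refine ⟨l, hl, ?_, ?_⟩
  · simpa using congrArg (fun k => k ≫ prod.fst) hl'
  · simpa using congrArg (fun k => k ≫ prod.snd) hl'

theorem pullbackSection_ε₀_mem {X : C} {I : RelationOn X} (hI : IsIdentityTypeOfObject R I)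
    {A : C} (α : A ⟶ X) : L (pullbackSection α I.η I.ε₀ I.η_ε₀) := by
  rw [← MorphismProperty.llp_eq_of_wfs L R]
  exact (hI.2 α).1

theorem pullbackSection_ε₁_mem {X : C} {I : RelationOn X} (hI : IsIdentityTypeOfObject R I)
    {A : C} (α : A ⟶ X) : L (pullbackSection α I.η I.ε₁ I.η_ε₁) := by
  rw [← MorphismProperty.llp_eq_of_wfs L R]
  exact (hI.2 α).2

theorem IsIdPresentation.isTypeTheoretic {I : CatRelation C} (hI : IsIdPresentation I L R) :
    IsTypeTheoretic L R := by
  have hm := hI.isModel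
  rw [hI.generates.2] at hm
  refine isTypeTheoretic_of_transport hI.generates fun {X Y} r hr => ?_
  -- Along the trivial paths, `t` extends the identity to a choice of start point over `ε₀`, and `T`
  -- extends the trivial path to one from `t` to the given point.
  have hL := pullbackSection_ε₁_mem (L := L) (hm Y) r
  obtain ⟨t, ht, ht'⟩ := exists_lift_of_wfs L R hL hr (𝟙 X)
    (pullback.snd _ _ ≫ (I.on Y).ε₀) (by simp [pullbackSection, (I.on Y).η_ε₀])
  obtain ⟨T, hT, hT₀, hT₁⟩ := exists_path_lift (hm X) hL (I.on X).η t (pullback.fst _ _)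
    (by rw [ht, (I.on X).η_ε₀]) (by rw [pullbackSection_fst, (I.on X).η_ε₁])
  exact ⟨T, by rw [reassoc_of% hT₀, ht'], hT₁, hT⟩

/-- The open boxes in `Ψ X`: pairs of paths starting at the two endpoints of a path. -/
noncomputable def openBox (I : CatRelation C) : SquareStructure I where
  sq X := pullback (pullback.snd (I.on X).ε₀ (I.on X).ε₀ ≫ (I.on X).ε₁) (I.on X).ε₀
  sqη X := pullback.lift (pullback.lift (I.on X).η (I.on X).η rfl) (I.on X).η
    (by simp [(I.on X).η_ε₀, (I.on X).η_ε₁])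
  e₀ X := pullback.fst _ _ ≫ pullback.fst _ _
  e₁ X := pullback.snd _ _
  ζ X := pullback.fst _ _ ≫ pullback.snd _ _
  δ X := pullback.lift (pullback.lift ((I.on X).ε₀ ≫ (I.on X).η) ((I.on X).ε₀ ≫ (I.on X).η) rfl)
    (𝟙 _) (by simp [(I.on X).η_ε₁])
  sqη_e₀ X := by simp
  sqη_e₁ X := by simp
  sqη_ζ X := by simp
  e₀_ε₀ X := by simp [pullback.condition]
  e₁_ε₀ X := by simp [pullback.condition]
  η_δ X := by
    apply pullback.hom_ext
    · apply pullback.hom_ext <;> simp [reassoc_of% (I.on X).η_ε₀]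
    · simp
  δ_e₀ X := by simp
  δ_ζ X := by simp
  δ_e₁ X := by simp

theorem openBox_hom_ext {I : CatRelation C} {W X : C} {a b : W ⟶ (openBox I).sq X}
    (h₀ : a ≫ (openBox I).e₀ X = b ≫ (openBox I).e₀ X)
    (h₁ : a ≫ (openBox I).e₁ X = b ≫ (openBox I).e₁ X)
    (hζ : a ≫ (openBox I).ζ X = b ≫ (openBox I).ζ X) : a = b := by
  refine pullback.hom_ext (pullback.hom_ext ?_ ?_) h₁
  · exact (Category.assoc _ _ _).trans (h₀.trans (Category.assoc _ _ _).symm)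
  · exact (Category.assoc _ _ _).trans (hζ.trans (Category.assoc _ _ _).symm)

theorem openBox_exists_lift (I : CatRelation C) {W X : C} (a₀ a₁ z : W ⟶ (I.on X).Ψ)
    (h₀ : a₀ ≫ (I.on X).ε₀ = z ≫ (I.on X).ε₀) (h₁ : a₁ ≫ (I.on X).ε₀ = z ≫ (I.on X).ε₁) :
    ∃ m : W ⟶ (openBox I).sq X,
      m ≫ (openBox I).e₀ X = a₀ ∧ m ≫ (openBox I).e₁ X = a₁ ∧ m ≫ (openBox I).ζ X = z :=
  ⟨pullback.lift (pullback.lift a₀ z h₀) a₁ (by simp [h₁]),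
    (pullback.lift_fst_assoc _ _ _ _).trans (pullback.lift_fst _ _ _),
    pullback.lift_snd _ _ _, (pullback.lift_fst_assoc _ _ _ _).trans (pullback.lift_snd _ _ _)⟩

/-- An open box over `f` with trivial base is just two paths starting at `f x`. Adding these one at
a time presents the unit as a composite of two pulled-back reflexivity sections, both in `L`. -/
theorem openBox_unit_mem {I : CatRelation C} (hI : IsModelOfIdTypesOfObjects R I) {X Y : C}
    (f : X ⟶ Y) : L ((openBox I).unit f) := by
  have h₁ : L (I.pathLam f) := pullbackSection_ε₀_mem (hI Y) f
  have h₂ := pullbackSection_ε₀_mem (L := L) (hI Y) (pullback.fst f (I.on Y).ε₀ ≫ f)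
  have hu₁ : (openBox I).unit f ≫ pullback.fst _ _ = 𝟙 X := pullback.lift_fst _ _ _
  have hu₂ : (openBox I).unit f ≫ pullback.snd _ _ = f ≫ (openBox I).sqη Y :=
    pullback.lift_snd _ _ _
  have hf₁ : (openBox I).face₀ f ≫ pullback.fst _ _ = pullback.fst _ _ := pullback.lift_fst _ _ _
  have hf₂ : (openBox I).face₀ f ≫ pullback.snd _ _ = pullback.snd _ _ ≫ (openBox I).e₀ Y :=
    pullback.lift_snd _ _ _
  have hc := pullback.condition (f := f ≫ (I.on Y).η) (g := (openBox I).ζ Y)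
  let i : (openBox I).dom f ⟶ pullback (pullback.fst f (I.on Y).ε₀ ≫ f) (I.on Y).ε₀ :=
    pullback.lift ((openBox I).face₀ f) (pullback.snd _ _ ≫ (openBox I).e₁ Y) (by
      rw [Category.assoc, (openBox I).e₁_ε₀, ← reassoc_of% hc, (I.on Y).η_ε₁, Category.comp_id,
        reassoc_of% hf₁])
  have hi₁ : i ≫ pullback.fst _ _ = (openBox I).face₀ f := pullback.lift_fst _ _ _
  have hi₂ : i ≫ pullback.snd _ _ = pullback.snd _ _ ≫ (openBox I).e₁ Y := pullback.lift_snd _ _ _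
  -- The box assembled from the two paths, on the trivial base at `f x`.
  obtain ⟨m, hm₀, hm₁, hmζ⟩ := openBox_exists_lift I
    (pullback.fst (pullback.fst f (I.on Y).ε₀ ≫ f) (I.on Y).ε₀ ≫ pullback.snd f (I.on Y).ε₀)
    (pullback.snd _ _) (pullback.fst _ _ ≫ pullback.fst _ _ ≫ f ≫ (I.on Y).η)
    (by simp [(I.on Y).η_ε₀, pullback.condition])
    (by simp [(I.on Y).η_ε₁, ← pullback.condition])
  let r : pullback (pullback.fst f (I.on Y).ε₀ ≫ f) (I.on Y).ε₀ ⟶ (openBox I).dom f :=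
    pullback.lift (pullback.fst _ _ ≫ pullback.fst _ _) m (by rw [hmζ, Category.assoc])
  have hr₁ : r ≫ pullback.fst _ _ = pullback.fst _ _ ≫ pullback.fst _ _ := pullback.lift_fst _ _ _
  have hr₂ : r ≫ pullback.snd _ _ = m := pullback.lift_snd _ _ _
  have hs₁ := pullbackSection_fst (pullback.fst f (I.on Y).ε₀ ≫ f) _ _ (I.on Y).η_ε₀
  have hs₂ := pullbackSection_snd (pullback.fst f (I.on Y).ε₀ ≫ f) _ _ (I.on Y).η_ε₀
  rw [Category.assoc] at hs₂
  refine left_of_retract R (left_comp R h₁ h₂) i r ?_ ?_ ?_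
  · apply pullback.hom_ext
    · rw [Category.assoc, Category.assoc, hi₁, hs₁, Category.comp_id]
      apply pullback.hom_ext
      · rw [Category.assoc, hf₁, hu₁, I.pathLam_fst]
      · rw [Category.assoc, hf₂, reassoc_of% hu₂, (openBox I).sqη_e₀, I.pathLam_snd]
    · rw [Category.assoc, Category.assoc, hi₂, hs₂, reassoc_of% hu₂, (openBox I).sqη_e₁,
        reassoc_of% I.pathLam_fst f]
  · apply pullback.hom_ext
    · rw [Category.assoc, Category.assoc, hr₁, reassoc_of% hs₁, I.pathLam_fst, hu₁]
    · rw [Category.assoc, Category.assoc, hr₂, hu₂]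
      apply openBox_hom_ext
      · simp only [Category.assoc, hm₀, (openBox I).sqη_e₀, reassoc_of% hs₁, I.pathLam_snd]
      · simp only [Category.assoc, hm₁, (openBox I).sqη_e₁, hs₂, reassoc_of% I.pathLam_fst f]
      · simp only [Category.assoc, hmζ, (openBox I).sqη_ζ, reassoc_of% hs₁,
          reassoc_of% I.pathLam_fst f]
  · apply pullback.hom_ext
    · rw [Category.assoc, hr₁, reassoc_of% hi₁, hf₁, Category.id_comp]
    · rw [Category.assoc, hr₂, Category.id_comp]
      apply openBox_hom_ext
      · rw [Category.assoc, hm₀, reassoc_of% hi₁, hf₂]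
      · rw [Category.assoc, hm₁, hi₂]
      · rw [Category.assoc, hmζ, reassoc_of% hi₁, reassoc_of% hf₁, hc]

theorem IsModelOfIdTypesOfObjects.isMooreRelationSystem (L : MorphismProperty C)
    [MorphismProperty.IsWeakFactorizationSystem L R] {I : CatRelation C}
    (hI : IsModelOfIdTypesOfObjects R I) : IsMooreRelationSystem I where
  transitive := by
    choose μ h h₀ h₁ using fun X => exists_path_lift (hI X)
      (pullbackSection_ε₀_mem (L := L) (hI X) (I.on X).ε₁) (𝟙 _)
      (pullback.fst _ _ ≫ (I.on X).ε₀) (pullback.snd _ _ ≫ (I.on X).ε₁)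
      (by simp [pullbackSection]) (by simp [pullbackSection, (I.on X).η_ε₁])
    exact ⟨⟨μ, h₀, h₁, h⟩⟩
  symmetric := by
    have hL (X : C) : L (pullback.lift ((I.on X).ε₀ ≫ (I.on X).η) (𝟙 (I.on X).Ψ)
        (by simp [(I.on X).η_ε₀]) : _ ⟶ pullback (I.on X).ε₀ (I.on X).ε₀) := by
      -- The unit of `ν` is a pulled-back reflexivity section up to swapping the two paths.
      refine left_of_retract R (pullbackSection_ε₀_mem (hI X) (I.on X).ε₀)
        (pullback.lift (pullback.snd _ _) (pullback.fst _ _) pullback.condition.symm)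
        (pullback.lift (pullback.snd _ _) (pullback.fst _ _) pullback.condition.symm) ?_ ?_ ?_
      all_goals apply pullback.hom_ext <;> simp [pullbackSection]
    choose ν h h₀ h₁ using fun X => exists_path_lift (hI X) (hL X) (𝟙 _)
      (pullback.fst _ _ ≫ (I.on X).ε₁) (pullback.snd _ _ ≫ (I.on X).ε₁)
      (by simp [(I.on X).η_ε₁]) (by simp)
    exact ⟨⟨ν, h₀, h₁, h⟩⟩
  homotopical := by
    have h₀ {X Y : C} (f : X ⟶ Y) : (openBox I).unit f ≫ (openBox I).face₀ f = I.pathLam f := by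
      apply pullback.hom_ext
      · simp [SquareStructure.unit, SquareStructure.face₀, I.pathLam_fst]
      · simp [SquareStructure.unit, SquareStructure.face₀, I.pathLam_snd, SquareStructure.sqη_e₀]
    have h₁ {X Y : C} (f : X ⟶ Y) : (openBox I).unit f ≫ (openBox I).face₁ f = I.pathLam f := by
      apply pullback.hom_ext
      · simp [SquareStructure.unit, SquareStructure.face₁, I.pathLam_fst]
      · simp [SquareStructure.unit, SquareStructure.face₁, I.pathLam_snd, SquareStructure.sqη_e₁]
    -- Both faces restrict to `I.pathLam f` along the unit, so the trivial path there extends to a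
    -- path between them.
    choose τ hτ hτ₀ hτ₁ using fun (X Y : C) (f : X ⟶ Y) => exists_path_lift (hI (I.pathObj f))
      (openBox_unit_mem (L := L) hI f) (I.pathLam f ≫ (I.on (I.pathObj f)).η)
      ((openBox I).face₀ f) ((openBox I).face₁ f)
      (by rw [Category.assoc, (I.on _).η_ε₀, Category.comp_id, h₀])
      (by rw [Category.assoc, (I.on _).η_ε₁, Category.comp_id, h₁])
    exact ⟨{ openBox I with
      τ := fun f => τ _ _ f
      unit_τ := fun f => hτ _ _ f
      τ_ε₀ := fun f => hτ₀ _ _ f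
      τ_ε₁ := fun f => hτ₁ _ _ f }⟩

end IdPresentation

end TypeTheoreticWFS

theorem theorem6p2 {C : Type u} [Category.{v} C] [HasFiniteLimits C]
    (L R : MorphismProperty C) [MorphismProperty.IsWeakFactorizationSystem L R] :
    List.TFAE [
      ∃ I : TypeTheoreticWFS.CatRelation C, TypeTheoreticWFS.IsIdPresentation I L R,
      TypeTheoreticWFS.IsTypeTheoretic L R,
      ∃ M : TypeTheoreticWFS.CatRelation C, TypeTheoreticWFS.IsMooreRelationSystem M ∧
        M.toFactorization.Generates L R,
      TypeTheoreticWFS.IsDisplayMapCategory R ∧ TypeTheoreticWFS.ModelsSigmaTypes R ∧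
        TypeTheoreticWFS.ModelsIdTypes R] := by
  have hR := TypeTheoreticWFS.right_isStableUnderBaseChange L R
  tfae_have 1 → 2 := fun ⟨_, hI⟩ => hI.isTypeTheoretic
  tfae_have 3 → 2 := fun ⟨_, hM, hg⟩ => hM.isTypeTheoretic hg
  tfae_have 2 → 4 := fun h => ⟨⟨fun f _ => TypeTheoreticWFS.right_of_isIso L R f,
    fun hT f => h.fibrant _ hT f, hR⟩, fun _ _ hf hg => TypeTheoreticWFS.right_comp L hf hg,
    h.modelsIdTypes⟩
  tfae_have 4 → 1 := by
    rintro ⟨hD, -, I, hI⟩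
    have hfib (X : C) : TypeTheoreticWFS.IsFibrant R X := fun hT f => hD.to_terminal hT f
    have hiso : R.RespectsIso := by
      rw [← MorphismProperty.rlp_eq_of_wfs L R]
      infer_instance
    -- Every `X ⟶ ⊤_ C` is a display map, so the slice over the terminal object has identity types
    -- for all objects.
    exact ⟨_, TypeTheoreticWFS.isIdPresentation_of_isModel hfib fun X =>
      TypeTheoreticWFS.isIdentityTypeOfObject_ofTerminalSlice (I _) X
        (hI _ (hD.to_terminal terminalIsTerminal _)) hiso⟩
  tfae_have 1 → 3 := by
    rintro ⟨I, hI⟩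
    have hm := hI.isModel
    rw [hI.generates.2] at hm
    exact ⟨I, hm.isMooreRelationSystem L, hI.generates⟩
  tfae_finish
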